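/- Let $k$ be a field, let $I$ be a set of cardinality $\aleph_\omega$, and let $R = \prod_{I} k$. Let $\mathsf{D}(R)$ be the derived category of $R$-modules, let $\mathsf{D}^{\mathrm{perf}}(R) \subseteq \mathsf{D}(R)$ be the full subcategory of perfect complexes (objects isomorphic to bounded complexes of finitely generated projective modules), and let $\mathsf{D}^{\mathrm b}(\mathrm{mod}\,R) \subseteq \mathsf{D}(R)$ be the bounded derived category of finitely presented modules (objects isomorphic to bounded complexes of finitely presented modules). Then: 1. $R$ is commutative, coherent (every finitely generated ideal is finitely presented) and von Neumann regular (for every $a \in R$ there is $b \in R$ with $aba = a$). 2. $R$ has infinite global dimension: the supremum of the projective dimensions of all $R$-modules is $\infty$. 3. Every object $X$ of $\mathsf{D}^{\mathrm b}(\mathrm{mod}\,R)$ is formal, i.e. isomorphic in $\mathsf{D}(R)$ to its cohomology, regarded as a complex with zero differentials; and $\mathsf{D}^{\mathrm b}(\mathrm{mod}\,R) = \mathsf{D}^{\mathrm{perf}}(R)$. 4. The triangulated category $\mathsf{D}^{\mathrm{perf}}(R)$ has Rouquier dimension $0$, where the Rouquier dimension of a triangulated category is the least $d \ge 0$ for which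 there is an object $G$ such that every object is obtained from $G$ by shifts, finite direct sums, direct summands and at most $d$ extensions ($\infty$ if there is none). Consequently $R$ is a counterexample to Neeman's claim that, for a commutative ring $R$, strong generation of $\mathsf{D}^{\mathrm{perf}}(R)$ implies finite global dimension, and $\operatorname{Spec} R$ is a counterexample to his claim that, for a quasi-compact separated scheme $X$, strong generation of $\mathsf{D}^{\mathrm{perf}}(X)$ implies that $X$ has a cover by open affine subschemes $\operatorname{Spec}(R_i)$ with all $R_i$ of finite global dimension. Precisely: 5. $\mathsf{D}^{\mathrm{perf}}(R)$ $(\simeq \mathsf{D}^{\mathrm{perf}}(\operatorname{Spec} R))$ is strongly generated: there are an object $G$ and an integer $d \ge 0$ such that every object is obtained from $G$ by shifts, finite direct sums, direct summands and at most $d$ extensions. 6. Every cover of $\operatorname{Spec} R$ by open affine subschemes has a member whose ring of global sections has infinite global dimension. -/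

import Mathlib

universe w v u

open CategoryTheory

/-- A ring is (left) coherent if each of its finitely generated left ideals is finitely
presented as a module. -/
def IsCoherentRing (R : Type u) [Ring R] : Prop :=
  ∀ I : Ideal R, I.FG → Module.FinitePresentation R I

/-- A ring is von Neumann regular if each element `a` can be written as `a * b * a`. -/
def IsVonNeumannRegularRing (R : Type u) [Ring R] : Prop :=
  ∀ a : R, ∃ b : R, a * b * a = a

/-- The (left) global dimension of a ring: the supremum of the projective dimensions of all its
modules. It is `⊤` exactly if it is infinite (and `⊥` exactly for the zero ring). -/
noncomputable def globalDimension (R : Type u) [Ring R] : WithBot ℕ∞ :=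
  ⨆ M : ModuleCat.{u} R, projectiveDimension M

/-- The objects of the derived category of `R`-modules that are isomorphic to a bounded cochain
complex whose terms all satisfy `P`. -/
def IsBoundedComplexOf {R : Type u} [Ring R] [HasDerivedCategory.{w} (ModuleCat.{u} R)]
    (P : ObjectProperty (ModuleCat.{u} R)) :
    ObjectProperty (DerivedCategory (ModuleCat.{u} R)) := fun X =>
  ∃ K : CochainComplex (ModuleCat.{u} R) ℤ,
    (∃ a : ℤ, K.IsStrictlyGE a) ∧ (∃ b : ℤ, K.IsStrictlyLE b) ∧ (∀ i : ℤ, P (K.X i)) ∧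
      Nonempty (X ≅ DerivedCategory.Q.obj K)

/-- Perfect complexes: the objects of the derived category of `R`-modules that are isomorphic to
a bounded complex of finitely generated projective modules. -/
def IsPerfectComplex (R : Type u) [Ring R] [HasDerivedCategory.{w} (ModuleCat.{u} R)] :
    ObjectProperty (DerivedCategory (ModuleCat.{u} R)) :=
  IsBoundedComplexOf fun M => Module.Finite R M ∧ Module.Projective R M

/-- The bounded derived category of finitely presented `R`-modules (for coherent `R`), as a full
subcategory of the derived category of all `R`-modules: the objects that are isomorphic to a
bounded complex of finitely presented modules. -/
def IsBoundedFinitelyPresented (R : Type u) [Ring R] [HasDerivedCategory.{w} (ModuleCat.{u} R)] :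
    ObjectProperty (DerivedCategory (ModuleCat.{u} R)) :=
  IsBoundedComplexOf fun M => Module.FinitePresentation R M

/-- The cohomology of an object of the derived category, as a complex with zero differentials. -/
noncomputable def cohomologyComplex {R : Type u} [Ring R]
    [HasDerivedCategory.{w} (ModuleCat.{u} R)] (X : DerivedCategory (ModuleCat.{u} R)) :
    CochainComplex (ModuleCat.{u} R) ℤ where
  X i := (DerivedCategory.homologyFunctor (ModuleCat.{u} R) i).obj X
  d _ _ := 0

/-- An object of the derived category is formal if it is isomorphic there to its cohomology, that
is, to the direct sum of the shifted modules `Hⁱ(X)[-i]`. -/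
def IsFormalComplex {R : Type u} [Ring R] [HasDerivedCategory.{w} (ModuleCat.{u} R)]
    (X : DerivedCategory (ModuleCat.{u} R)) : Prop :=
  Nonempty (X ≅ DerivedCategory.Q.obj (cohomologyComplex X))

namespace IsPerfectComplex

open Limits ZeroObject DerivedCategory Pretriangulated CochainComplex HomologicalComplex

theorem finite_projective_of_isZero (R : Type u) [Ring R] {M : ModuleCat.{u} R} (h : IsZero M) :
    Module.Finite R M ∧ Module.Projective R M := by
  have := ModuleCat.subsingleton_of_isZero h
  have := Module.Free.of_subsingleton R M
  exact ⟨inferInstance, Module.Projective.of_free⟩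

variable (R : Type u) [Ring R] [HasDerivedCategory.{w} (ModuleCat.{u} R)]

instance : (IsPerfectComplex.{w} R).IsClosedUnderIsomorphisms where
  of_iso := by
    rintro X Y e ⟨K, ha, hb, hK, ⟨e'⟩⟩
    exact ⟨K, ha, hb, hK, ⟨e.symm ≪≫ e'⟩⟩

instance : (IsPerfectComplex.{w} R).ContainsZero where
  exists_zero := by
    have h : Limits.IsZero (0 : CochainComplex (ModuleCat.{u} R) ℤ) := Limits.isZero_zero _
    have h' (i : ℤ) : Limits.IsZero ((0 : CochainComplex (ModuleCat.{u} R) ℤ).X i) :=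
      (HomologicalComplex.eval _ _ i).map_isZero h
    exact ⟨Q.obj 0, Q.map_isZero h, 0,
      ⟨0, (isStrictlyGE_iff _ _).2 fun i _ => h' i⟩,
      ⟨0, (isStrictlyLE_iff _ _).2 fun i _ => h' i⟩,
      fun i => finite_projective_of_isZero R (h' i), ⟨Iso.refl _⟩⟩

instance : (IsPerfectComplex.{w} R).IsStableUnderShift ℤ where
  isStableUnderShiftBy n := ⟨by
    rintro X ⟨K, ⟨a, ha⟩, ⟨b, hb⟩, hK, ⟨e⟩⟩
    exact ⟨K⟦n⟧, ⟨a - n, K.isStrictlyGE_shift a n _ (by lia)⟩,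
      ⟨b - n, K.isStrictlyLE_shift b n _ (by lia)⟩, fun i => hK (i + n),
      ⟨(CategoryTheory.shiftFunctor _ n).mapIso e ≪≫ ((Q.commShiftIso n).app K).symm⟩⟩⟩

instance : (IsPerfectComplex.{w} R).IsTriangulatedClosed₂ :=
  .mk' <| by
    rintro T hT ⟨K, ⟨a, ha⟩, ⟨b, hb⟩, hK, ⟨e⟩⟩ h₃
    obtain ⟨L, ⟨a', ha'⟩, ⟨b', hb'⟩, hL, ⟨e'⟩⟩ :=
      (IsPerfectComplex.{w} R).le_shift (-1 : ℤ) _ h₃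
    have (n : ℤ) : Projective (L.X n) := by
      have := (hL n).2
      infer_instance
    have := isKProjective_of_projective L b'
    have hT' := inv_rot_of_distTriang _ hT
    obtain ⟨f, hf⟩ : ∃ f : L ⟶ K, Q.map f = e'.inv ≫ T.invRotate.mor₁ ≫ e.hom := by
      obtain ⟨g, hg⟩ := (IsKProjective.Qh_map_bijective L
        ((HomotopyCategory.quotient _ _).obj K)).surjective
          ((quotientCompQhIso _).hom.app L ≫ (e'.inv ≫ T.invRotate.mor₁ ≫ e.hom) ≫
            (quotientCompQhIso _).inv.app K)
      obtain ⟨f, rfl⟩ := (HomotopyCategory.quotient _ _).map_surjective g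
      refine ⟨f, ?_⟩
      have := quotientCompQhIso_hom_naturality f
      rw [hg] at this
      simpa using this.symm
    let φ : T.obj₂ ≅ Q.obj (mappingCone f) := Triangle.π₃.mapIso
      (isoTriangleOfIso₁₂ _ _ hT' (mappingCone_triangle_distinguished f) e' e
        (show T.invRotate.mor₁ ≫ e.hom = e'.hom ≫ Q.map f by
          rw [hf]
          exact (e'.hom_inv_id_assoc _).symm))
    refine ⟨mappingCone f, ⟨min a (a' - 1), (isStrictlyGE_iff _ _).2 fun i hi => ?_⟩,
      ⟨max b (b' - 1), (isStrictlyLE_iff _ _).2 fun i hi => ?_⟩, fun i => ?_, ⟨φ⟩⟩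
    · rw [mappingCone.isZero_X_iff]
      exact ⟨L.isZero_of_isStrictlyGE a' _ (by lia), K.isZero_of_isStrictlyGE a _ (by lia)⟩
    · rw [mappingCone.isZero_X_iff]
      exact ⟨L.isZero_of_isStrictlyLE b' _ (by lia), K.isZero_of_isStrictlyLE b _ (by lia)⟩
    · have := (hL (i + 1)).1
      have := (hL (i + 1)).2
      have := (hK i).1
      have := (hK i).2
      have ε : (mappingCone f).X i ≅ ModuleCat.of R (L.X (i + 1) × K.X i) :=
        homotopyCofiber.XIsoBiprod f i (i + 1) rfl ≪≫ ModuleCat.biprodIsoProd _ _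
      exact ⟨Module.Finite.equiv ε.toLinearEquiv.symm,
        Module.Projective.of_equiv ε.toLinearEquiv.symm⟩

/-- Perfect complexes form a triangulated subcategory of the derived category. -/
instance : (IsPerfectComplex.{w} R).IsTriangulated where

end IsPerfectComplex

/-- The triangulated category of perfect complexes over `R`. -/
abbrev PerfectDerivedCategory (R : Type u) [Ring R] [HasDerivedCategory.{w} (ModuleCat.{u} R)] :=
  (IsPerfectComplex.{w} R).FullSubcategory

section Rouquier

open Limits Pretriangulated

/-- The Rouquier dimension of a triangulated category: the least `d` such that, for some single
object `G`, every object is obtained from `G` by shifts, finite direct sums, direct summands and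
at most `d` extensions; it is `⊤` if there is no such `d`. -/
noncomputable def rouquierDimension (T : Type*) [Category* T] [HasZeroObject T] [HasShift T ℤ]
    [Preadditive T] [∀ n : ℤ, (shiftFunctor T n).Additive] [Pretriangulated T] : ℕ∞ :=
  ⨅ (d : ℕ) (_ : ∃ G : T, (ObjectProperty.singleton G).triangEnvelopeIter d = ⊤), (d : ℕ∞)

end Rouquier

/-! ### Kuratowski's theorem on powers of a set -/

section Kuratowski

open Cardinal Function

/-! Infinite global dimension follows Osofsky. Take `n + 1` families `e j` of orthogonal idempotents
indexed by `X`, with all products `∏ e i (x i)` nonzero. Each row ideal `I j` is projective with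
local units, so the tensor product of the complexes `I j → R` is a projective resolution, of length
`n + 1`, of `R ⧸ (I 0 + ⋯ + I n)`. If that module had projective dimension at most `n`, the top
differential would have a left inverse `s`. Apply `s` to the boundary of `e 0 (x 0) ⊗ ⋯ ⊗ e n (x
n)`: the generator becomes a sum of terms `e i (x i) • g i x`, with `g i x` independent of `x i`.
Along the `i`-th direction the coefficient of `g i x` at `x` is thus nonzero only finitely often. As
`X` has at least `ℵ_ω` elements, Kuratowski's theorem gives an `x` where all these coefficients
vanish, whereas the generator has coefficient `∏ e i (x i) ≠ 0`. For functions on `ι`, identify `ι`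
with `ι ^ (n + 1)` and use indicators of coordinate hyperplanes.

The remaining claims rest on regularity: finitely generated ideals are generated by idempotents, so
all modules are flat and finitely presented ones are projective. Bounded complexes of these have
finitely generated projective cohomology, hence are formal and are retracts of finite sums of shifts
of `R`. Compact opens of the spectrum are cut out by idempotents; in an affine cover one of finitely
many supports still has at least `ℵ_ω` points, and its sections are again a power of `k`. -/

theorem exists_forall_notMem_of_finite_update {X : Type u} (S : ℕ → Set X)
    (hS : ∀ i, #(S i) = ℵ_ (i + 1 : ℕ)) (N : ℕ) (A : ℕ → Set (ℕ → X))
    (hA : ∀ i < N, ∀ x : ℕ → X, {v | update x i v ∈ A i}.Finite) (x₀ : ℕ → X) :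
    ∃ x : ℕ → X, (∀ j, N ≤ j → x j = x₀ j) ∧ (∀ j < N, x j ∈ S j) ∧ ∀ i < N, x ∉ A i := by
  -- Only `n` coordinates are free, and they range over sets of size at most `ℵ_ n`.
  have hZ (n : ℕ) (x₀ : ℕ → X) :
      #{x : ℕ → X | (∀ j, n ≤ j → x j = x₀ j) ∧ ∀ j < n, x j ∈ S j} ≤ ℵ_ (n : ℕ) := by
    induction n with
    | zero =>
      have : {x : ℕ → X | (∀ j, 0 ≤ j → x j = x₀ j) ∧ ∀ j < 0, x j ∈ S j} ⊆ {x₀} :=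
        fun x hx => funext fun j => hx.1 j (Nat.zero_le j)
      refine (mk_le_mk_of_subset this).trans ?_
      simp
    | succ n ih =>
      have : {x : ℕ → X | (∀ j, n + 1 ≤ j → x j = x₀ j) ∧ ∀ j < n + 1, x j ∈ S j} ⊆
          (fun p : (ℕ → X) × X => update p.1 n p.2) ''
            ({x : ℕ → X | (∀ j, n ≤ j → x j = x₀ j) ∧ ∀ j < n, x j ∈ S j} ×ˢ S n) := by
        rintro x ⟨h₁, h₂⟩
        refine ⟨(update x n (x₀ n), x n), ⟨⟨fun j hj => ?_, fun j hj => ?_⟩, h₂ n (by lia)⟩, ?_⟩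
        · obtain rfl | hj' := hj.eq_or_lt
          · simp
          · simpa [hj'.ne'] using h₁ j hj'
        · simpa [hj.ne] using h₂ j (by lia)
        · simp
      refine (mk_le_mk_of_subset this).trans (mk_image_le.trans ?_)
      rw [mk_setProd, hS]
      refine (mul_le_mul_left ih _).trans ?_
      have : ℵ_ (n : ℕ) ≤ ℵ_ (n + 1 : ℕ) := aleph_le_aleph.2 (by exact_mod_cast n.le_succ)
      exact (mul_le_mul_left this _).trans (mul_eq_self (aleph0_le_aleph _)).le
  induction N generalizing x₀ with
  | zero => exact ⟨x₀, fun _ _ => rfl, by simp, by simp⟩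
  | succ N ih =>
    set Z := {x : ℕ → X | (∀ j, N ≤ j → x j = x₀ j) ∧ ∀ j < N, x j ∈ S j}
    -- Choose the last coordinate first: at most `ℵ_ N` lines, each with finitely many bad values,
    -- cannot exhaust `S N`, of size `ℵ_ (N + 1)`. The value found avoids `A N` whatever the lower
    -- coordinates will be.
    have hB : #(⋃ z : Z, {v | update z.1 N v ∈ A N}) ≤ ℵ_ (N : ℕ) := by
      refine (mk_iUnion_le _).trans ?_
      refine (mul_le_mul' (hZ N x₀) (ciSup_le' fun z => ?_)).trans
        (mul_eq_self (aleph0_le_aleph _)).le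
      exact ((hA N N.lt_succ_self z.1).lt_aleph0.le).trans (aleph0_le_aleph _)
    obtain ⟨v, hvS, hv⟩ : ∃ v ∈ S N, v ∉ ⋃ z : Z, {v | update z.1 N v ∈ A N} := by
      by_contra! h
      have := (mk_le_mk_of_subset h).trans hB
      rw [hS, aleph_le_aleph] at this
      exact absurd this (not_le.2 (by exact_mod_cast N.lt_succ_self))
    obtain ⟨x, hx₁, hx₂, hx₃⟩ := ih (fun i hi => hA i (by lia)) (update x₀ N v)
    have hxN : x N = v := by simpa using hx₁ N le_rfl
    refine ⟨x, fun j hj => ?_, fun j hj => ?_, fun i hi => ?_⟩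
    · simpa [show j ≠ N by lia] using hx₁ j (by lia)
    · obtain hj | rfl := Nat.lt_succ_iff_lt_or_eq.1 hj
      · exact hx₂ j hj
      · rwa [hxN]
    · obtain hi | rfl := Nat.lt_succ_iff_lt_or_eq.1 hi
      · exact hx₃ i hi
      · refine fun hxA => hv (Set.mem_iUnion.2 ⟨⟨update x i (x₀ i), fun j hj => ?_, fun j hj => ?_⟩,
          ?_⟩)
        · obtain rfl | hj' := hj.eq_or_lt
          · simp
          · simpa [hj'.ne'] using hx₁ j hj
        · simpa [hj.ne] using hx₂ j hj
        · simpa [← hxN] using hxA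

/-- Kuratowski's theorem: if `X` has at least `ℵ_ω` elements, no finite power of `X` is a union of
sets `A i` all of whose sections in the `i`-th direction are finite. -/
theorem exists_forall_notMem_of_aleph_omega_le {X : Type u} (hX : ℵ_ Ordinal.omega0 ≤ #X) (N : ℕ)
    (A : ℕ → Set (ℕ → X)) (hA : ∀ i < N, ∀ x : ℕ → X, {v | update x i v ∈ A i}.Finite) :
    ∃ x : ℕ → X, ∀ i < N, x ∉ A i := by
  have h (i : ℕ) : ∃ S : Set X, #S = ℵ_ (i + 1 : ℕ) :=
    le_mk_iff_exists_set.1 ((aleph_le_aleph.2 (Ordinal.natCast_lt_omega0 _).le).trans hX)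
  choose S hS using h
  have : Nonempty X := mk_ne_zero_iff.1 ((aleph_pos _).trans_le hX).ne'
  obtain ⟨x, -, -, hx⟩ :=
    exists_forall_notMem_of_finite_update S hS N A hA fun _ => Classical.arbitrary X
  exact ⟨x, hx⟩

end Kuratowski

/-! ### Dimension shifting along a projective resolution -/

section ProjectiveDimension

variable {R : Type u} [Ring R]

/-- By exactness `g` embeds `P₁ ⧸ range f` into `P₀` with cokernel `P₀ ⧸ range g`: the former is a
syzygy of the latter. -/
theorem Function.Exact.hasProjectiveDimensionLT_range_quotient {P₀ P₁ P₂ : Type u}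
    [AddCommGroup P₀] [Module R P₀] [AddCommGroup P₁] [Module R P₁] [AddCommGroup P₂] [Module R P₂]
    [Module.Projective R P₀] {f : P₂ →ₗ[R] P₁} {g : P₁ →ₗ[R] P₀} (h : Function.Exact f g) (n : ℕ)
    [H : HasProjectiveDimensionLT (ModuleCat.of R (P₀ ⧸ LinearMap.range g)) (n + 2)] :
    HasProjectiveDimensionLT (ModuleCat.of R (P₁ ⧸ LinearMap.range f)) (n + 1) := by
  have hr : LinearMap.range f = LinearMap.ker g := h.linearMap_ker_eq.symm
  let i : (P₁ ⧸ LinearMap.range f) →ₗ[R] P₀ := (LinearMap.range f).liftQ g hr.le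
  have hi : Function.Injective i := by
    rw [← LinearMap.ker_eq_bot, Submodule.ker_liftQ, ← hr, Submodule.mkQ_map_self]
  let S : ShortComplex (ModuleCat.{u} R) :=
    ShortComplex.mk (ModuleCat.ofHom i) (ModuleCat.ofHom (LinearMap.range g).mkQ) (by
      refine ModuleCat.hom_ext (LinearMap.ext fun x => ?_)
      obtain ⟨x, rfl⟩ := Submodule.Quotient.mk_surjective _ x
      exact (Submodule.Quotient.mk_eq_zero _).2 (LinearMap.mem_range_self g x))
  have hS : S.ShortExact := by
    have : Mono S.f := (ModuleCat.mono_iff_injective _).2 hi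
    have : Epi S.g := (ModuleCat.epi_iff_surjective _).2 (Submodule.mkQ_surjective _)
    refine ⟨(ShortComplex.ShortExact.moduleCat_exact_iff_function_exact S).2 ?_⟩
    rw [LinearMap.exact_iff]
    change LinearMap.ker (LinearMap.range g).mkQ = LinearMap.range i
    rw [Submodule.ker_mkQ, Submodule.range_liftQ]
  have : Projective S.X₂ := (IsProjective.iff_projective P₀).1 inferInstance
  exact (hS.hasProjectiveDimensionLT_X₃_iff n inferInstance).1 H

/-- After `n` shifts the cokernel of `d n` is projective, so its range is a direct summand; `d n` is
injective because `P (n + 2)` vanishes. -/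
theorem exists_leftInverse_of_hasProjectiveDimensionLT (P : ℕ → ModuleCat.{u} R)
    [∀ m, Module.Projective R (P m)] (d : ∀ m, P (m + 1) →ₗ[R] P m)
    (hd : ∀ m, Function.Exact (d (m + 1)) (d m)) (n : ℕ)
    [HasProjectiveDimensionLT (ModuleCat.of R (P 0 ⧸ LinearMap.range (d 0))) (n + 1)]
    [Subsingleton (P (n + 2))] :
    ∃ s : P n →ₗ[R] P (n + 1), ∀ x, s (d n x) = x := by
  have key (m l : ℕ) (h : m + l = n) :
      HasProjectiveDimensionLT (ModuleCat.of R (P m ⧸ LinearMap.range (d m))) (l + 1) := by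
    induction m generalizing l with
    | zero =>
      obtain rfl : l = n := by lia
      assumption
    | succ m ih =>
      have := ih (l + 1) (by lia)
      exact (hd m).hasProjectiveDimensionLT_range_quotient l
  have := key n 0 (by lia)
  have hp : Module.Projective R (P n ⧸ LinearMap.range (d n)) :=
    (IsProjective.iff_projective _).2 (projective_iff_hasProjectiveDimensionLT_one.2 this)
  have hinj : Function.Injective (d n) := by
    rw [injective_iff_map_eq_zero]
    intro x hx
    obtain ⟨y, rfl⟩ := (hd n x).1 hx
    rw [Subsingleton.elim y 0, map_zero]
  obtain ⟨s, hs⟩ := Module.projective_lifting_property (LinearMap.range (d n)).mkQ LinearMap.id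
    (Submodule.mkQ_surjective _)
  have hmem (x : P n) : x - s ((LinearMap.range (d n)).mkQ x) ∈ LinearMap.range (d n) := by
    refine (Submodule.Quotient.mk_eq_zero _).1 ?_
    rw [Submodule.Quotient.mk_sub, sub_eq_zero]
    exact (LinearMap.congr_fun hs _).symm
  let e := LinearEquiv.ofInjective (d n) hinj
  refine ⟨e.symm.toLinearMap ∘ₗ LinearMap.codRestrict _
    (LinearMap.id - s ∘ₗ (LinearMap.range (d n)).mkQ) hmem, fun x => ?_⟩
  simp only [LinearMap.comp_apply, LinearEquiv.coe_coe]
  rw [LinearEquiv.symm_apply_eq]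
  ext
  have : (LinearMap.range (d n)).mkQ (d n x) = 0 := by
    exact (Submodule.Quotient.mk_eq_zero _).2 (LinearMap.mem_range_self _ x)
  simp [e, LinearMap.codRestrict_apply, this, -Submodule.mkQ_apply]

end ProjectiveDimension

/-! ### Koszul complexes of ideals with local units -/

section Koszul

open scoped TensorProduct

variable {R : Type u} [CommRing R] (I : ℕ → Ideal R)

/-- The terms of the Koszul complex `(I 0 → R) ⊗ ⋯ ⊗ (I (j - 1) → R)` of a sequence of
ideals. -/
noncomputable def koszul : ℕ → ℕ → ModuleCat.{u} R
  | 0, 0 => ModuleCat.of R R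
  | 0, _ + 1 => ModuleCat.of R PUnit
  | j + 1, 0 => koszul j 0
  | j + 1, m + 1 => ModuleCat.of R ((I j ⊗[R] koszul j m) × koszul j (m + 1))

/-- The multiplication map of an ideal on a module. -/
noncomputable def Ideal.tensorAction (J : Ideal R) (M : Type u) [AddCommGroup M] [Module R M] :
    J ⊗[R] M →ₗ[R] M :=
  TensorProduct.lift ((LinearMap.lsmul R M).domRestrict J)

@[simp]
theorem Ideal.tensorAction_tmul (J : Ideal R) (M : Type u) [AddCommGroup M] [Module R M] (a : J)
    (m : M) : J.tensorAction M (a ⊗ₜ m) = (a : R) • m := rfl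

theorem Ideal.tensorAction_lTensor (J : Ideal R) {M N : Type u} [AddCommGroup M] [Module R M]
    [AddCommGroup N] [Module R N] (f : M →ₗ[R] N) (t : J ⊗[R] M) :
    J.tensorAction N (f.lTensor J t) = f (J.tensorAction M t) := by
  induction t with
  | zero => simp
  | tmul a m => simp
  | add x y hx hy => simp [hx, hy]

theorem Ideal.tmul_tensorAction (J : Ideal R) {M : Type u} [AddCommGroup M] [Module R M] (a : J)
    (t : J ⊗[R] M) : a ⊗ₜ[R] J.tensorAction M t = (a : R) • t := by
  induction t with
  | zero => simp
  | tmul b m =>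
    rw [tensorAction_tmul, ← TensorProduct.smul_tmul, TensorProduct.smul_tmul']
    congr 1
    ext
    simp [mul_comm]
  | add x y hx hy => simp [TensorProduct.tmul_add, hx, hy]

/-- The differential of the Koszul complex of a sequence of ideals. -/
noncomputable def koszulD : ∀ j m : ℕ, koszul I j (m + 1) →ₗ[R] koszul I j m
  | 0, _ => 0
  | j + 1, 0 => ((I j).tensorAction (koszul I j 0)).coprod (koszulD j 0)
  | j + 1, m + 1 =>
    (-((koszulD j m).lTensor (I j)) ∘ₗ LinearMap.fst R _ _).prod
      (((I j).tensorAction (koszul I j (m + 1))).coprod (koszulD j (m + 1)))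

theorem koszulD_succ_zero (j : ℕ) (t : I j ⊗[R] koszul I j 0) (p : koszul I j 1) :
    koszulD I (j + 1) 0 (t, p) = (I j).tensorAction _ t + koszulD I j 0 p := by
  simp only [koszulD]; rfl

theorem koszulD_succ_succ (j m : ℕ) (t : I j ⊗[R] koszul I j (m + 1)) (p : koszul I j (m + 2)) :
    koszulD I (j + 1) (m + 1) (t, p) =
      (-(koszulD I j m).lTensor (I j) t, (I j).tensorAction _ t + koszulD I j (m + 1) p) := by
  simp only [koszulD]; rfl

theorem koszulD_comp_koszulD (j m : ℕ) (z : koszul I j (m + 2)) :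
    koszulD I j m (koszulD I j (m + 1) z) = 0 := by
  induction j generalizing m with
  | zero => simp [koszulD]
  | succ j ih =>
    obtain ⟨t, p⟩ := z
    rw [koszulD_succ_succ]
    cases m with
    | zero =>
      rw [koszulD_succ_zero, map_neg, Ideal.tensorAction_lTensor, map_add, ih, add_zero]
      exact neg_add_cancel _
    | succ m =>
      rw [koszulD_succ_succ]
      have : (koszulD I j m).lTensor (I j) ((koszulD I j (m + 1)).lTensor (I j) t) = 0 := by
        rw [← LinearMap.comp_apply, ← LinearMap.lTensor_comp]
        rw [show koszulD I j m ∘ₗ koszulD I j (m + 1) = 0 from LinearMap.ext fun z => ih m z]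
        simp
      rw [map_neg, map_neg, this, Ideal.tensorAction_lTensor, map_add, ih]
      simp
      rfl

/-- An ideal has local units if each of its elements is fixed by multiplication with some
element of the ideal. -/
def Ideal.HasLocalUnits (J : Ideal R) : Prop := ∀ a ∈ J, ∃ u ∈ J, u * a = a

/-- `u + v - u * v = 1 - (1 - u) * (1 - v)`, which gives a common local unit. -/
theorem add_sub_mul_smul_eq {M : Type*} [AddCommGroup M] [Module R M] {u v : R} {x : M}
    (h : u • x = x ∨ v • x = x) : (u + v - u * v) • x = x := by
  obtain h | h := h
  · rw [sub_smul, add_smul, mul_comm, mul_smul, h, add_sub_cancel_right]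
  · rw [sub_smul, add_smul, mul_smul, h, add_sub_cancel_left]

theorem Ideal.HasLocalUnits.exists_smul_eq {J : Ideal R} (hJ : J.HasLocalUnits) {M : Type u}
    [AddCommGroup M] [Module R M] (t : J ⊗[R] M) : ∃ u ∈ J, u • t = t := by
  induction t with
  | zero => exact ⟨0, J.zero_mem, by simp⟩
  | tmul a m =>
    obtain ⟨u, hu, h⟩ := hJ a a.2
    refine ⟨u, hu, ?_⟩
    rw [TensorProduct.smul_tmul']
    congr 1
    exact Subtype.ext h
  | add x y hx hy =>
    obtain ⟨u, hu, hx⟩ := hx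
    obtain ⟨v, hv, hy⟩ := hy
    refine ⟨u + v - u * v, J.sub_mem (J.add_mem hu hv) (J.mul_mem_left u hv), ?_⟩
    rw [smul_add]
    exact congr_arg₂ _ (add_sub_mul_smul_eq (.inl hx)) (add_sub_mul_smul_eq (.inr hy))

/-- For a cycle `(t, p)` choose a local unit `u` of `t`. Then `(1 - u) • p` is a cycle of the
shorter complex, hence a boundary `d w`, and `(u ⊗ p, w)` bounds `(t, p)`. -/
theorem koszulD_exact (hI : ∀ j, (I j).HasLocalUnits) (j m : ℕ) :
    Function.Exact (koszulD I j (m + 1)) (koszulD I j m) := by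
  intro z
  refine ⟨fun hz => ?_, ?_⟩
  · induction j generalizing m with
    | zero => exact ⟨0, rfl⟩
    | succ j ih =>
      obtain ⟨t, p⟩ := z
      have hz : (I j).tensorAction _ t + koszulD I j m p = 0 := by
        cases m with
        | zero => rwa [koszulD_succ_zero] at hz
        | succ m =>
          rw [koszulD_succ_succ] at hz
          exact congr_arg Prod.snd hz
      have hz : koszulD I j m p = -(I j).tensorAction _ t := (neg_eq_of_add_eq_zero_right hz).symm
      obtain ⟨u, hu, hut⟩ := (hI j).exists_smul_eq t
      obtain ⟨w, hw⟩ := ih m ((1 - u) • p) (by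
        rw [map_smul, hz, smul_neg, sub_smul, one_smul, ← map_smul, hut, sub_self, neg_zero])
      refine ⟨((⟨u, hu⟩ : I j) ⊗ₜ p, w), ?_⟩
      rw [koszulD_succ_succ, LinearMap.lTensor_tmul, hz, hw, TensorProduct.tmul_neg,
        Ideal.tmul_tensorAction, neg_neg, hut, Ideal.tensorAction_tmul, ← add_smul,
        add_sub_cancel, one_smul]
  · rintro ⟨w, rfl⟩
    exact koszulD_comp_koszulD I j m w

instance koszul_projective [∀ j, Module.Projective R (I j)] (j m : ℕ) :
    Module.Projective R (koszul I j m) := by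
  induction j generalizing m with
  | zero =>
    cases m with
    | zero => exact inferInstanceAs (Module.Projective R R)
    | succ m =>
      have : Module.Free R PUnit.{u + 1} := Module.Free.of_subsingleton R _
      exact inferInstanceAs (Module.Projective R PUnit.{u + 1})
  | succ j ih =>
    cases m with
    | zero => exact ih 0
    | succ m =>
      exact inferInstanceAs (Module.Projective R ((I j ⊗[R] koszul I j m) × koszul I j (m + 1)))

theorem subsingleton_koszul {j m : ℕ} (h : j < m) : Subsingleton (koszul I j m) := by
  induction j generalizing m with
  | zero =>
    obtain ⟨m, rfl⟩ := Nat.exists_eq_succ_of_ne_zero h.ne'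
    exact inferInstanceAs (Subsingleton PUnit.{u + 1})
  | succ j ih =>
    obtain ⟨m, rfl⟩ := Nat.exists_eq_succ_of_ne_zero (Nat.ne_zero_of_lt h)
    have := ih (m := m) (by lia)
    have := ih (m := m + 1) (by lia)
    have : Subsingleton (I j ⊗[R] koszul I j m) := subsingleton_of_forall_eq 0 fun x => by
      induction x with
      | zero => rfl
      | tmul a p => rw [Subsingleton.elim p 0, TensorProduct.tmul_zero]
      | add x y hx hy => rw [hx, hy, add_zero]
    exact inferInstanceAs (Subsingleton ((I j ⊗[R] koszul I j m) × koszul I j (m + 1)))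

end Koszul

/-! ### Ideals generated by orthogonal idempotents -/

section OrthogonalIdempotents

variable {R : Type u} [CommRing R] {X : Type v} {e : X → R}

theorem Ideal.exists_mul_eq_of_mem_span {s : Set R} (hs : ∀ a ∈ s, IsIdempotentElem a) {a : R}
    (ha : a ∈ Ideal.span s) : ∃ u ∈ Ideal.span s, u * a = a := by
  induction ha using Submodule.span_induction with
  | mem a h => exact ⟨a, Ideal.subset_span h, hs a h⟩
  | zero => exact ⟨0, zero_mem _, by simp⟩
  | add a b _ _ ha hb =>
    obtain ⟨u, hu, ha⟩ := ha
    obtain ⟨v, hv, hb⟩ := hb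
    refine ⟨u + v - u * v, sub_mem (add_mem hu hv) (Ideal.mul_mem_left _ u hv), ?_⟩
    rw [mul_add]
    have h₁ : (u + v - u * v) • a = a := add_sub_mul_smul_eq (.inl ha)
    have h₂ : (u + v - u * v) • b = b := add_sub_mul_smul_eq (.inr hb)
    exact congr_arg₂ (· + ·) h₁ h₂
  | smul r a _ ha =>
    obtain ⟨u, hu, ha⟩ := ha
    exact ⟨u, hu, by rw [smul_eq_mul, mul_left_comm, ha]⟩

theorem OrthogonalIdempotents.finite_setOf_mul_ne_zero (he : OrthogonalIdempotents e) {a : R}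
    (ha : a ∈ Ideal.span (Set.range e)) : {x | e x * a ≠ 0}.Finite := by
  induction ha using Submodule.span_induction with
  | mem a h =>
    obtain ⟨y, rfl⟩ := h
    refine (Set.finite_singleton y).subset fun x hx => ?_
    by_contra h
    exact hx (he.ortho h)
  | zero => simp
  | add a b _ _ ha hb =>
    refine (ha.union hb).subset fun x hx => ?_
    by_contra! h
    simp only [Set.mem_union, Set.mem_ofPred_eq, not_or, not_not] at h
    exact hx (by rw [mul_add, h.1, h.2, add_zero])
  | smul r a _ ha =>
    refine ha.subset fun x hx h => hx ?_
    rw [smul_eq_mul, mul_left_comm, h, mul_zero]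

theorem OrthogonalIdempotents.sum_mul_eq (he : OrthogonalIdempotents e) {a : R}
    (ha : a ∈ Ideal.span (Set.range e)) {s : Finset X} (hs : ∀ x, e x * a ≠ 0 → x ∈ s) :
    ∑ x ∈ s, e x * a = a := by
  -- The finsum does not mention `s`, so the induction need not carry it.
  have key : ∑ᶠ x, e x * a = a := by
    clear hs
    induction ha using Submodule.span_induction with
    | mem a h =>
      obtain ⟨y, rfl⟩ := h
      rw [finsum_eq_single _ y fun x hx => he.ortho hx, he.idem y]
    | zero => simp
    | add a b ha' hb' ha hb =>
      simp only [mul_add]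
      rw [finsum_add_distrib (he.finite_setOf_mul_ne_zero ha') (he.finite_setOf_mul_ne_zero hb'),
        ha, hb]
    | smul r a ha' ha =>
      simp only [smul_eq_mul, mul_left_comm _ r]
      rw [← mul_finsum' _ _ (he.finite_setOf_mul_ne_zero ha'), ha]
  rw [← finsum_eq_sum_of_support_subset, key]
  exact fun x hx => hs x hx

/-- The map `a ↦ (e x * a)ₓ` splits the surjection from the free module on `X`. -/
theorem OrthogonalIdempotents.projective_span (he : OrthogonalIdempotents e) :
    Module.Projective R (Ideal.span (Set.range e)) := by
  let I := Ideal.span (Set.range e)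
  let s : (X →₀ R) →ₗ[R] I :=
    Finsupp.linearCombination R fun x => (⟨e x, Ideal.subset_span ⟨x, rfl⟩⟩ : I)
  let i : I →ₗ[R] X →₀ R :=
    { toFun a := Finsupp.ofSupportFinite (fun x => e x * a)
        (he.finite_setOf_mul_ne_zero a.2)
      map_add' a b := Finsupp.ext fun x => mul_add _ _ _
      map_smul' r a := Finsupp.ext fun x => mul_left_comm _ _ _ }
  refine Module.Projective.of_split i s (LinearMap.ext fun a => Subtype.ext ?_)
  simp only [LinearMap.comp_apply, s, Finsupp.linearCombination_apply, Finsupp.sum,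
    LinearMap.id_apply, AddSubmonoidClass.coe_finsetSum, SetLike.val_smul, smul_eq_mul]
  refine (Finset.sum_congr rfl fun x _ => ?_).trans
    (he.sum_mul_eq a.2 (s := (i a).support) fun x hx => Finsupp.mem_support_iff.2 hx)
  change e x * a * e x = _
  rw [mul_right_comm, he.idem x]

end OrthogonalIdempotents

/-! ### Osofsky's lower bound -/

section Koszul

open scoped TensorProduct
open Function

variable {R : Type u} [CommRing R] {X : Type v} (e : ℕ → X → R)

/-- The ideals generated by the rows of a family of elements. -/
abbrev rowIdeal (j : ℕ) : Ideal R := Ideal.span (Set.range (e j))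

/-- The inclusion of the first summand of a term of the Koszul complex. -/
noncomputable def koszulInl (I : ℕ → Ideal R) (j m : ℕ) :
    I j ⊗[R] koszul I j m →ₗ[R] koszul I (j + 1) (m + 1) :=
  LinearMap.inl R _ _

/-- The inclusion of the second summand of a term of the Koszul complex. -/
noncomputable def koszulInr (I : ℕ → Ideal R) (j m : ℕ) :
    koszul I j (m + 1) →ₗ[R] koszul I (j + 1) (m + 1) :=
  LinearMap.inr R _ _

theorem koszulD_koszulInl_zero (I : ℕ → Ideal R) (j : ℕ) (t : I j ⊗[R] koszul I j 0) :
    koszulD I (j + 1) 0 (koszulInl I j 0 t) = (I j).tensorAction (koszul I j 0) t := by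
  refine (koszulD_succ_zero I j t 0).trans ?_
  rw [map_zero, add_zero]

theorem koszulD_koszulInl_succ (I : ℕ → Ideal R) (j m : ℕ)
    (t : I j ⊗[R] koszul I j (m + 1)) :
    koszulD I (j + 1) (m + 1) (koszulInl I j (m + 1) t) =
      koszulInr I j m ((I j).tensorAction _ t) -
        koszulInl I j m ((koszulD I j m).lTensor (I j) t) := by
  refine (koszulD_succ_succ I j m t 0).trans ?_
  rw [map_zero, add_zero, sub_eq_neg_add]
  refine Prod.ext ?_ ?_
  · change _ = -_ + _
    exact (add_zero _).symm
  · change _ = -_ + _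
    exact (zero_add _).symm.trans (congr_arg (· + _) neg_zero.symm)

/-- The generator of the Koszul complex of the empty sequence. -/
def koszulOne (I : ℕ → Ideal R) : koszul I 0 0 := (1 : R)

/-- The generators of the ideals generated by the rows of a family of elements. -/
def rowIdealGen (j : ℕ) (v : X) : rowIdeal e j := ⟨e j v, Ideal.subset_span ⟨v, rfl⟩⟩

/-- The element `e 0 (x 0) ⊗ ⋯ ⊗ e (j - 1) (x (j - 1))` in the top degree of the Koszul complex. -/
noncomputable def koszulTop (x : ℕ → X) : ∀ j : ℕ, koszul (rowIdeal e) j j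
  | 0 => koszulOne _
  | j + 1 => koszulInl _ j j (rowIdealGen e j (x j) ⊗ₜ koszulTop x j)

/-- The coefficient at `x` of an element in the top degree of the Koszul complex. -/
noncomputable def koszulCoeff (x : ℕ → X) : ∀ j : ℕ, koszul (rowIdeal e) j j →ₗ[R] R
  | 0 => (LinearMap.id : R →ₗ[R] R)
  | j + 1 => TensorProduct.lift ((LinearMap.mul R R).compl₁₂
      (LinearMap.mulLeft R (e j (x j)) ∘ₗ (rowIdeal e j).subtype) (koszulCoeff x j)) ∘ₗ
        LinearMap.fst R _ _

theorem koszulCoeff_koszulInl_tmul (x : ℕ → X) (j : ℕ) (a : rowIdeal e j)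
    (p : koszul (rowIdeal e) j j) :
    koszulCoeff e x (j + 1) (koszulInl _ j j (a ⊗ₜ p)) = e j (x j) * a * koszulCoeff e x j p :=
  rfl

theorem koszulCoeff_koszulTop (x : ℕ → X) (j : ℕ) :
    koszulCoeff e x j (koszulTop e x j) = ∏ i ∈ Finset.range j, e i (x i) * e i (x i) := by
  induction j with
  | zero => rfl
  | succ j ih =>
    rw [Finset.prod_range_succ, mul_comm, ← ih]
    exact koszulCoeff_koszulInl_tmul e x j _ _

variable {e}

theorem koszulTop_congr {x y : ℕ → X} {j : ℕ} (h : ∀ i < j, x i = y i) :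
    koszulTop e x j = koszulTop e y j := by
  induction j with
  | zero => rfl
  | succ j ih => rw [koszulTop, koszulTop, ih fun i hi => h i (by lia), h j (by lia)]

/-- In a pure tensor the `i`-th factor lies in `rowIdeal e i`, so almost all `e i v` annihilate it.
-/
theorem finite_setOf_koszulCoeff_update_ne_zero (he : ∀ j, OrthogonalIdempotents (e j))
    (x : ℕ → X) {i j : ℕ} (hij : i < j) (p : koszul (rowIdeal e) j j) :
    {v | koszulCoeff e (update x i v) j p ≠ 0}.Finite := by
  induction j with
  | zero => lia
  | succ j ih =>
    obtain ⟨t, p'⟩ := p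
    change {v | koszulCoeff e (update x i v) (j + 1) (koszulInl _ j j t) ≠ 0}.Finite
    induction t with
    | zero => simp
    | tmul a p =>
      simp only [koszulCoeff_koszulInl_tmul]
      obtain hij | rfl := Nat.lt_succ_iff_lt_or_eq.1 hij
      · refine (ih hij p).subset fun v hv h => hv ?_
        rw [h, mul_zero]
      · refine ((he i).finite_setOf_mul_ne_zero a.2).subset fun v hv h => hv ?_
        rw [update_self, h, zero_mul]
    | add s t hs ht =>
      refine (hs.union ht).subset fun v hv => ?_
      by_contra! h
      simp only [Set.mem_union, Set.mem_ofPred_eq, not_or, not_not] at h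
      exact hv (by rw [map_add, map_add, h.1, h.2, add_zero])

/-- Up to sign, `g i x` is `φ` of the tensor with its `i`-th factor deleted, whence its independence
of `x i`. -/
theorem exists_koszulD_koszulTop_eq_sum {M : Type*} [AddCommGroup M] [Module R M] (j : ℕ)
    (φ : koszul (rowIdeal e) (j + 1) j →ₗ[R] M) :
    ∃ g : ℕ → (ℕ → X) → M, (∀ x, φ (koszulD _ (j + 1) j (koszulTop e x (j + 1))) =
      ∑ i ∈ Finset.range (j + 1), e i (x i) • g i x) ∧
        ∀ i ≤ j, ∀ x v, g i (update x i v) = g i x := by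
  induction j with
  | zero =>
    refine ⟨fun _ _ => φ (koszulOne (rowIdeal e)), fun x => ?_, fun _ _ _ _ => rfl⟩
    rw [koszulTop, koszulTop, koszulD_koszulInl_zero, Ideal.tensorAction_tmul]
    refine (map_smul φ _ _).trans ?_
    simp [rowIdealGen]
  | succ j ih =>
    -- The last factor, with index `y`, is absorbed into the linear map; the resulting `g` may
    -- depend on `y`.
    have (y : X) := ih (φ ∘ₗ koszulInl _ (j + 1) j ∘ₗ
      TensorProduct.mk R (rowIdeal e (j + 1)) _ (rowIdealGen e (j + 1) y))
    choose g hg hgu using this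
    refine ⟨fun i x => if i = j + 1 then φ (koszulInr _ (j + 1) j (koszulTop e x (j + 1))) else
      - g (x (j + 1)) i x, fun x => ?_, fun i hi x v => ?_⟩
    · have h : ∑ i ∈ Finset.range (j + 1), e i (x i) • (if i = j + 1 then
          φ (koszulInr _ (j + 1) j (koszulTop e x (j + 1))) else - g (x (j + 1)) i x) =
          - φ (koszulInl _ (j + 1) j (rowIdealGen e (j + 1) (x (j + 1)) ⊗ₜ
            koszulD _ (j + 1) j (koszulTop e x (j + 1)))) := by
        refine Eq.trans ?_ (congr_arg Neg.neg (hg (x (j + 1)) x).symm)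
        rw [← Finset.sum_neg_distrib]
        refine Finset.sum_congr rfl fun i hi => ?_
        rw [if_neg (Finset.mem_range.1 hi).ne, smul_neg]
      rw [Finset.sum_range_succ, h, koszulTop, koszulD_koszulInl_succ, map_sub,
        LinearMap.lTensor_tmul, Ideal.tensorAction_tmul, map_smul, map_smul, sub_eq_neg_add]
      simp [rowIdealGen]
    · obtain rfl | hi' := eq_or_ne i (j + 1)
      · simp only [if_true]
        rw [koszulTop_congr fun l hl => update_of_ne hl.ne v x]
      · simp only [if_neg hi', update_of_ne hi'.symm, hgu _ i (by lia)]

/-- Osofsky's lower bound for the projective dimension. -/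
theorem not_hasProjectiveDimensionLT_of_orthogonalIdempotents
    (hX : Cardinal.aleph Ordinal.omega0 ≤ Cardinal.mk X) (he : ∀ j, OrthogonalIdempotents (e j))
    (n : ℕ) (hn : ∀ x : ℕ → X, ∏ i ∈ Finset.range (n + 1), e i (x i) ≠ 0) :
    ∃ M : ModuleCat.{u} R, ¬ HasProjectiveDimensionLT M (n + 1) := by
  have (j : ℕ) : Module.Projective R (rowIdeal e j) := (he j).projective_span
  have hu (j : ℕ) : (rowIdeal e j).HasLocalUnits := fun a ha =>
    Ideal.exists_mul_eq_of_mem_span (by rintro _ ⟨x, rfl⟩; exact (he j).idem x) ha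
  -- This is `R ⧸ (I 0 + ⋯ + I n)` for the row ideals `I j`.
  refine ⟨ModuleCat.of R (koszul (rowIdeal e) (n + 1) 0 ⧸
    LinearMap.range (koszulD (rowIdeal e) (n + 1) 0)), fun h => ?_⟩
  have := subsingleton_koszul (rowIdeal e) (show n + 1 < n + 2 by lia)
  obtain ⟨s, hs⟩ := exists_leftInverse_of_hasProjectiveDimensionLT (koszul (rowIdeal e) (n + 1))
    (koszulD (rowIdeal e) (n + 1)) (koszulD_exact _ hu (n + 1)) n
  obtain ⟨g, hg, hgu⟩ := exists_koszulD_koszulTop_eq_sum n s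
  obtain ⟨x, hx⟩ := exists_forall_notMem_of_aleph_omega_le hX (n + 1)
    (fun i => {x | koszulCoeff e x (n + 1) (g i x) ≠ 0}) fun i hi x => by
      simpa only [Set.mem_ofPred_eq, hgu i (Nat.le_of_lt_succ hi)] using
        finite_setOf_koszulCoeff_update_ne_zero he x hi (g i x)
  simp only [Set.mem_ofPred_eq, not_not] at hx
  have h₁ := congr_arg (koszulCoeff e x (n + 1)) (hg x)
  rw [hs, koszulCoeff_koszulTop, map_sum] at h₁
  refine hn x ?_
  -- Idempotence turns the product into the product of squares that the coefficient of the generator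
  -- produces.
  rw [Finset.prod_congr rfl fun i _ => ((he i).idem (x i)).eq.symm, h₁]
  refine Finset.sum_eq_zero fun i hi => ?_
  rw [map_smul, hx i (Finset.mem_range.1 hi), smul_zero]

end Koszul

/-! ### Global dimension of powers of a ring -/

section GlobalDimension

theorem globalDimension_eq_top_of_forall {R : Type u} [Ring R]
    (h : ∀ n : ℕ, ∃ M : ModuleCat.{u} R, ¬ HasProjectiveDimensionLT M (n + 1)) :
    globalDimension R = ⊤ := by
  by_contra hR
  obtain ⟨n, hn⟩ : ∃ n : ℕ, globalDimension R ≤ n := by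
    induction hd : globalDimension R with
    | bot => exact ⟨0, bot_le⟩
    | coe d =>
      induction d with
      | top => exact absurd hd hR
      | coe d => exact ⟨d, le_rfl⟩
  obtain ⟨M, hM⟩ := h n
  exact hM ((projectiveDimension_le_iff M n).1 ((le_iSup projectiveDimension M).trans hn))

attribute [local instance] RingHomInvPair.of_ringEquiv in
theorem globalDimension_le_of_ringEquiv {R S : Type u} [Ring R] [Ring S] (e : R ≃+* S) :
    globalDimension R ≤ globalDimension S := by
  refine iSup_le fun M => ?_
  let N := (ModuleCat.restrictScalars e.symm.toRingHom).obj M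
  let f : M ≃ₛₗ[RingHomClass.toRingHom e] N :=
    { AddEquiv.refl M with
      map_smul' r m := by
        change r • m = e.symm (e r) • m
        rw [e.symm_apply_apply] }
  rw [ModuleCat.projectiveDimension_eq_of_semiLinearEquiv e f]
  exact le_iSup (projectiveDimension (C := ModuleCat.{u} S)) N

theorem globalDimension_eq_of_ringEquiv {R S : Type u} [Ring R] [Ring S] (e : R ≃+* S) :
    globalDimension R = globalDimension S :=
  (globalDimension_le_of_ringEquiv e).antisymm (globalDimension_le_of_ringEquiv e.symm)

theorem globalDimension_pi_eq_top {k : Type u} [CommRing k] [Nontrivial k] {ι : Type v}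
    (hι : Cardinal.aleph Ordinal.omega0 ≤ Cardinal.mk ι) : globalDimension (ι → k) = ⊤ := by
  classical
  refine globalDimension_eq_top_of_forall fun n => ?_
  have hι' := (Cardinal.aleph0_le_aleph _).trans hι
  obtain ⟨c⟩ : Nonempty (ι ≃ (Fin (n + 1) → ι)) := by
    refine Cardinal.eq.1 ?_
    rw [Cardinal.mk_arrow, Cardinal.mk_fin, Cardinal.lift_natCast, Cardinal.lift_uzero,
      Cardinal.power_natCast, Cardinal.power_nat_eq hι' (by lia)]
  have : Nonempty ι := Cardinal.mk_ne_zero_iff.1 ((Cardinal.aleph_pos _).trans_le hι).ne'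
  -- The `j`-th coordinate under `ι ≃ ι ^ (n + 1)`. The value for `j > n` is arbitrary: fibre
  -- indicators of any function are orthogonal idempotents.
  let f (j : ℕ) (p : ι) : ι := if h : j < n + 1 then c p ⟨j, h⟩ else p
  refine not_hasProjectiveDimensionLT_of_orthogonalIdempotents
    (e := fun j x p => if f j p = x then 1 else 0) hι (fun j => ⟨fun x => ?_, fun x y h => ?_⟩) n
    fun x hx => ?_
  · ext p
    by_cases h : f j p = x <;> simp [h]
  · ext p
    by_cases h' : f j p = x
    · simp [h', h]
    · simp [h']
  · have := congr_fun hx (c.symm fun i => x i)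
    rw [Finset.prod_apply, Finset.prod_eq_one fun i hi => ?_] at this
    · exact one_ne_zero this
    · rw [Finset.mem_range] at hi
      refine if_pos ?_
      simp only [f]
      rw [dif_pos hi, Equiv.apply_symm_apply]

end GlobalDimension

/-! ### Modules over von Neumann regular rings -/

section VonNeumannRegular

open scoped TensorProduct

theorem isVonNeumannRegularRing_pi {k : Type u} [Field k] {ι : Type v} :
    IsVonNeumannRegularRing (ι → k) :=
  fun a => ⟨a⁻¹, funext fun i => mul_inv_mul_cancel (a i)⟩

variable {R : Type u} [CommRing R]

theorem IsVonNeumannRegularRing.exists_isIdempotentElem_span (hR : IsVonNeumannRegularRing R)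
    {I : Ideal R} (hI : I.FG) : ∃ e, IsIdempotentElem e ∧ I = Ideal.span {e} := by
  refine (Ideal.isIdempotentElem_iff_of_fg I hI).1 (le_antisymm Ideal.mul_le_left fun a ha => ?_)
  obtain ⟨b, hb⟩ := hR a
  rw [← hb]
  exact Ideal.mul_mem_mul (I.mul_mem_right b ha) ha

/-- For an ideal generated by an idempotent `e`, each `t` in its tensor product with `M` equals `e ⊗
m`, with `m` the image of `t` in `M`. -/
theorem IsVonNeumannRegularRing.flat (hR : IsVonNeumannRegularRing R) (M : Type v) [AddCommGroup M] [Module R M] :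
    Module.Flat R M := by
  refine Module.Flat.iff_lift_lsmul_comp_subtype_injective.2 fun I hI => ?_
  obtain ⟨e, he, rfl⟩ := hR.exists_isIdempotentElem_span hI
  rw [injective_iff_map_eq_zero]
  intro t ht
  have key (t : Submodule.span R {e} ⊗[R] M) : (⟨e, Submodule.mem_span_singleton_self e⟩ :
      Submodule.span R {e}) ⊗ₜ[R] TensorProduct.lift ((LinearMap.lsmul R M).comp
        (Submodule.subtype (Submodule.span R {e}))) t = t := by
    induction t with
    | zero => simp
    | tmul a m =>
      obtain ⟨a, ha⟩ := a
      obtain ⟨r, rfl⟩ := Submodule.mem_span_singleton.1 ha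
      simp only [TensorProduct.lift.tmul]
      change _ ⊗ₜ[R] ((r • e) • m) = _
      rw [← TensorProduct.smul_tmul]
      congr 1
      ext
      simp [mul_assoc, he.eq]
    | add x y hx hy => rw [map_add, TensorProduct.tmul_add, hx, hy]
  rw [← key t, ht, TensorProduct.tmul_zero]

theorem IsVonNeumannRegularRing.projective (hR : IsVonNeumannRegularRing R) (M : Type v) [AddCommGroup M] [Module R M]
    [Module.FinitePresentation R M] : Module.Projective R M :=
  have := hR.flat M
  Module.Flat.projective_of_finitePresentation

/-- `M ⧸ N` is finitely presented, hence projective, so `N` is a direct summand of `M`. -/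
theorem IsVonNeumannRegularRing.finitePresentation_submodule (hR : IsVonNeumannRegularRing R)
    {M : Type v} [AddCommGroup M] [Module R M] [Module.FinitePresentation R M] (N : Submodule R M)
    (hN : N.FG) : Module.FinitePresentation R N := by
  have : Module.FinitePresentation R (M ⧸ N) :=
    Module.finitePresentation_of_surjective N.mkQ N.mkQ_surjective (by rwa [N.ker_mkQ])
  have := hR.projective (M ⧸ N)
  exact Module.finitePresentation_of_projective_of_exact N.subtype N.mkQ N.injective_subtype
    N.mkQ_surjective (LinearMap.exact_subtype_mkQ N)

theorem IsVonNeumannRegularRing.isCoherentRing (hR : IsVonNeumannRegularRing R) : IsCoherentRing R :=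
  fun I hI => hR.finitePresentation_submodule I hI

theorem IsVonNeumannRegularRing.fg_ker (hR : IsVonNeumannRegularRing R) {M N : Type v} [AddCommGroup M] [Module R M] [AddCommGroup N]
    [Module R N] [Module.FinitePresentation R M] [Module.FinitePresentation R N] (f : M →ₗ[R] N) :
    (LinearMap.ker f).FG := by
  have := hR.finitePresentation_submodule (LinearMap.range f) (Module.Finite.iff_fg.1 inferInstance)
  have := Module.FinitePresentation.fg_ker f.rangeRestrict f.surjective_rangeRestrict
  rwa [LinearMap.ker_rangeRestrict] at this

theorem IsVonNeumannRegularRing.finitePresentation_homology (hR : IsVonNeumannRegularRing R) (S : ShortComplex (ModuleCat.{v} R))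
    [Module.FinitePresentation R S.X₁] [Module.FinitePresentation R S.X₂]
    [Module.FinitePresentation R S.X₃] : Module.FinitePresentation R S.homology := by
  have := hR.finitePresentation_submodule _ (hR.fg_ker S.g.hom)
  have : Module.FinitePresentation R (LinearMap.ker S.g.hom ⧸ LinearMap.range S.moduleCatToCycles) :=
    Module.finitePresentation_of_surjective (Submodule.mkQ _) (Submodule.mkQ_surjective _)
      (by rw [Submodule.ker_mkQ]; exact Module.Finite.iff_fg.1 inferInstance)
  have : Module.FinitePresentation R S.moduleCatLeftHomologyData.H := this
  exact Module.FinitePresentation.of_equiv S.moduleCatHomologyIso.symm.toLinearEquiv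

end VonNeumannRegular

/-! ### Formality -/

section Formal

variable {R : Type u} [Ring R] [HasDerivedCategory.{w} (ModuleCat.{u} R)]

open HomologicalComplex in
/-- A complex whose cohomology modules are projective is formal. -/
theorem isFormalComplex_of_projective_homology {X : DerivedCategory (ModuleCat.{u} R)}
    {K : CochainComplex (ModuleCat.{u} R) ℤ} (e : X ≅ DerivedCategory.Q.obj K)
    [∀ i, Projective (K.homology i)] : IsFormalComplex X := by
  let α (i : ℤ) : (cohomologyComplex X).X i ≅ K.homology i :=
    (DerivedCategory.homologyFunctor _ i).mapIso e ≪≫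
      (DerivedCategory.homologyFunctorFactors _ i).app K
  -- Projectivity lifts cohomology classes to cycles; these lifts form a chain map from the
  -- zero-differential complex.
  let s (i : ℤ) : K.homology i ⟶ K.cycles i := Projective.factorThru (𝟙 _) (K.homologyπ i)
  have hs (i : ℤ) : s i ≫ K.homologyπ i = 𝟙 _ := Projective.factorThru_comp _ _
  let f : cohomologyComplex X ⟶ K :=
    { f i := (α i).hom ≫ s i ≫ K.iCycles i
      comm' i j _ := by
        rw [Category.assoc, Category.assoc, K.iCycles_d, Limits.comp_zero, Limits.comp_zero]
        exact Limits.zero_comp.symm }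
  have hf : QuasiIso f := by
    refine ⟨fun i => (quasiIsoAt_iff_isIso_homologyMap f i).2 ?_⟩
    -- With zero differentials, terms, cycles and homology agree, and under this identification `f`
    -- induces `α i`.
    let l := (cohomologyComplex X).liftCycles (𝟙 _) ((ComplexShape.up ℤ).next i) rfl
      ((Category.id_comp _).trans rfl)
    have hl : IsIso l := by
      have h₁ : l ≫ (cohomologyComplex X).iCycles i = 𝟙 _ := liftCycles_i _ _ _ _ _
      exact ⟨_, h₁, by
        rw [← cancel_mono ((cohomologyComplex X).iCycles i), Category.assoc, h₁, Category.id_comp,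
          Category.comp_id]⟩
    have hπ : IsIso ((cohomologyComplex X).homologyπ i) :=
      isIso_homologyπ _ _ i rfl rfl
    have h : l ≫ (cohomologyComplex X).homologyπ i ≫ homologyMap f i = (α i).hom := by
      rw [homologyπ_naturality, liftCycles_comp_cyclesMap_assoc]
      have h' : K.liftCycles (𝟙 _ ≫ f.f i) _ rfl (by
          rw [Category.assoc, f.comm]
          exact (Category.id_comp _).trans Limits.zero_comp) = (α i).hom ≫ s i := by
        rw [← cancel_mono (K.iCycles i), liftCycles_i, Category.id_comp, Category.assoc]
      exact (congr_arg (· ≫ K.homologyπ i) h').trans (by rw [Category.assoc, hs, Category.comp_id])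
    have : IsIso (l ≫ (cohomologyComplex X).homologyπ i ≫ homologyMap f i) := h ▸ inferInstance
    have := IsIso.of_isIso_comp_left l ((cohomologyComplex X).homologyπ i ≫ homologyMap f i)
    exact IsIso.of_isIso_comp_left ((cohomologyComplex X).homologyπ i) (homologyMap f i)
  exact ⟨e ≪≫ (asIso (DerivedCategory.Q.map f)).symm⟩

end Formal

/-! ### Complexes of finitely presented modules over regular rings -/

section VonNeumannRegular

theorem IsVonNeumannRegularRing.finite_projective_homology {R : Type u} [CommRing R]
    (hR : IsVonNeumannRegularRing R)
    (K : CochainComplex (ModuleCat.{u} R) ℤ) (hK : ∀ i, Module.FinitePresentation R (K.X i))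
    (i : ℤ) : Module.Finite R (K.homology i) ∧ Module.Projective R (K.homology i) := by
  have : Module.FinitePresentation R (K.sc i).X₁ := hK _
  have : Module.FinitePresentation R (K.sc i).X₂ := hK _
  have : Module.FinitePresentation R (K.sc i).X₃ := hK _
  have : Module.FinitePresentation R (K.homology i) := hR.finitePresentation_homology (K.sc i)
  exact ⟨inferInstance, hR.projective _⟩

variable {R : Type u} [CommRing R] [HasDerivedCategory.{w} (ModuleCat.{u} R)]

theorem IsVonNeumannRegularRing.isBoundedFinitelyPresented_eq (hR : IsVonNeumannRegularRing R) :
    IsBoundedFinitelyPresented.{w} R = IsPerfectComplex.{w} R := by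
  unfold IsBoundedFinitelyPresented IsPerfectComplex
  congr 1
  ext M
  refine ⟨fun h => ⟨inferInstance, hR.projective M⟩, fun ⟨_, _⟩ => ?_⟩
  exact Module.finitePresentation_of_projective R M

theorem IsVonNeumannRegularRing.isFormalComplex (hR : IsVonNeumannRegularRing R)
    {X : DerivedCategory (ModuleCat.{u} R)} (hX : IsBoundedFinitelyPresented.{w} R X) :
    IsFormalComplex X := by
  obtain ⟨K, -, -, hK, ⟨e⟩⟩ := hX
  have (i : ℤ) : Projective (K.homology i) :=
    (IsProjective.iff_projective _).1 (hR.finite_projective_homology K hK i).2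
  exact isFormalComplex_of_projective_homology e

end VonNeumannRegular

/-! ### Factoring sums of maps through one object -/

section RetractClosure

open Limits

/-- Applied to a decomposition of the identity, this exhibits `X` as a retract. The object `G`
serves the empty sum, as `P` need not contain zero. -/
theorem CategoryTheory.ObjectProperty.exists_factors_sum {C : Type*} [Category* C] [Preadditive C]
    [HasBinaryBiproducts C] (P : ObjectProperty C) [P.IsClosedUnderBinaryProducts] {G : C}
    (hG : P G) {X : C} {J : Type*} (s : Finset J) (A : J → C) (hA : ∀ j ∈ s, P (A j))
    (p : ∀ j, X ⟶ A j) (i : ∀ j, A j ⟶ X) :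
    ∃ (Y : C) (_ : P Y) (p' : X ⟶ Y) (i' : Y ⟶ X), p' ≫ i' = ∑ j ∈ s, p j ≫ i j := by
  classical
  induction s using Finset.induction_on with
  | empty => exact ⟨G, hG, 0, 0, by simp⟩
  | insert j s hj ih =>
    obtain ⟨Y, hY, p', i', h⟩ := ih fun l hl => hA l (Finset.mem_insert_of_mem hl)
    refine ⟨A j ⊞ Y, P.prop_of_isLimit_binaryFan (BinaryBiproduct.isLimit _ _)
      (hA j (Finset.mem_insert_self _ _)) hY, biprod.lift (p j) p', biprod.desc (i j) i', ?_⟩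
    rw [biprod.lift_desc, h, Finset.sum_insert hj]

end RetractClosure

/-! ### Rouquier dimension zero -/

section Rouquier

open Limits HomologicalComplex DerivedCategory

theorem exists_id_eq_sum_comp {R : Type u} [Ring R] (M : ModuleCat.{u} R) [Module.Finite R M]
    [Module.Projective R M] : ∃ (n : ℕ) (p : Fin n → (M ⟶ ModuleCat.of R R))
      (i : Fin n → (ModuleCat.of R R ⟶ M)), ∑ k, p k ≫ i k = 𝟙 M := by
  obtain ⟨n, f, g, -, -, h⟩ := Module.Finite.exists_comp_eq_id_of_projective R M
  refine ⟨n, fun k => ModuleCat.ofHom (LinearMap.proj k ∘ₗ g),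
    fun k => ModuleCat.ofHom (f ∘ₗ LinearMap.single R (fun _ => R) k), ?_⟩
  ext x
  rw [ModuleCat.hom_sum, LinearMap.sum_apply]
  simp only [ModuleCat.hom_comp, ModuleCat.hom_ofHom, LinearMap.comp_apply, LinearMap.proj_apply]
  rw [← map_sum]
  refine (congr_arg f ?_).trans (LinearMap.congr_fun h x)
  exact LinearMap.sum_single_apply _ _

/-- With zero differentials, maps in a single degree are chain maps, so degreewise decompositions of
the identity assemble. -/
theorem HomologicalComplex.sum_comp_single_eq_id {C ι : Type*} [Category* C] [Preadditive C]
    [HasZeroObject C] [DecidableEq ι] {c : ComplexShape ι} (L : HomologicalComplex C c)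
    (hL : ∀ i j, L.d i j = 0) {s : Finset ι} (hs : ∀ i ∉ s, IsZero (L.X i)) {A : C} {n : ι → ℕ}
    (p : ∀ i, Fin (n i) → (L.X i ⟶ A)) (q : ∀ i, Fin (n i) → (A ⟶ L.X i))
    (hpq : ∀ i, ∑ k, p i k ≫ q i k = 𝟙 (L.X i)) :
    ∑ j ∈ s.sigma fun i => (Finset.univ : Finset (Fin (n i))),
      (mkHomToSingle (p j.1 j.2) fun l _ => by rw [hL, zero_comp] : L ⟶ (single C c j.1).obj A) ≫
        (mkHomFromSingle (q j.1 j.2) fun l _ => by rw [hL, comp_zero]) = 𝟙 L := by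
  refine HomologicalComplex.hom_ext _ _ fun j => ?_
  by_cases hj : j ∈ s
  · rw [HomologicalComplex.id_f, ← hpq j, ← HomologicalComplex.eval_map, Functor.map_sum,
      Finset.sum_sigma, Finset.sum_eq_single_of_mem j hj fun i _ hij => ?_]
    · refine Finset.sum_congr rfl fun k _ => ?_
      simp
    · refine Finset.sum_eq_zero fun k _ => ?_
      rw [HomologicalComplex.eval_map, comp_f,
        (isZero_single_obj_X c i A j hij.symm).eq_zero_of_tgt (HomologicalComplex.Hom.f _ j),
        zero_comp]
      rfl
  · exact (hs j hj).eq_of_src _ _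

theorem isPerfectComplex_singleFunctor (R : Type u) [Ring R]
    [HasDerivedCategory.{w} (ModuleCat.{u} R)] (i : ℤ) :
    IsPerfectComplex.{w} R ((singleFunctor _ i).obj (ModuleCat.of R R)) := by
  refine ⟨(single _ _ i).obj (ModuleCat.of R R), ⟨i, inferInstance⟩, ⟨i, inferInstance⟩,
    fun j => ?_, ⟨Iso.refl _⟩⟩
  by_cases h : j = i
  · subst h
    have e := (singleObjXSelf (.up ℤ) j (ModuleCat.of R R)).toLinearEquiv
    exact ⟨Module.Finite.equiv e.symm, Module.Projective.of_equiv e.symm⟩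
  · exact IsPerfectComplex.finite_projective_of_isZero R (isZero_single_obj_X _ _ _ _ h)

/-- By formality `X` is its cohomology: finitely many nonzero modules, each a summand of some `R ^
n`. Its identity thus factors through a finite sum of shifts of `R`. -/
theorem IsVonNeumannRegularRing.triangEnvelopeIter_zero_eq_top {R : Type u} [CommRing R]
    [HasDerivedCategory.{w} (ModuleCat.{u} R)] (hR : IsVonNeumannRegularRing R) :
    (ObjectProperty.singleton (C := PerfectDerivedCategory.{w} R)
      ⟨_, isPerfectComplex_singleFunctor R 0⟩).triangEnvelopeIter 0 = ⊤ := by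
  rw [ObjectProperty.triangEnvelopeIter_zero, eq_top_iff]
  rintro Xp -
  obtain ⟨X, hX, rfl⟩ : ∃ X hX, Xp = ⟨X, hX⟩ := ⟨_, Xp.2, rfl⟩
  set Xp : PerfectDerivedCategory.{w} R := ⟨X, hX⟩
  set G : PerfectDerivedCategory.{w} R := ⟨_, isPerfectComplex_singleFunctor R 0⟩
  set P := ((ObjectProperty.singleton G).shiftClosure ℤ).binaryProductsClosure
  have hP (i : ℤ) : P ⟨_, isPerfectComplex_singleFunctor R i⟩ := by
    refine ObjectProperty.le_limitsClosure _ _ _ ⟨G, -i, ?_, by simp⟩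
    exact ObjectProperty.isoMk _ ((((singleFunctors (ModuleCat.{u} R)).shiftIso (-i) i 0
      (by simp)).app (ModuleCat.of R R)).symm ≪≫
        ((IsPerfectComplex.{w} R).ι.commShiftIso (-i)).symm.app G)
  have hf : IsFormalComplex X := hR.isFormalComplex (hR.isBoundedFinitelyPresented_eq ▸ hX)
  obtain ⟨e⟩ := hf
  obtain ⟨K, ⟨a, ha⟩, ⟨b, hb⟩, hK, ⟨e'⟩⟩ := hX
  set L := cohomologyComplex X
  let α (i : ℤ) : L.X i ≅ K.homology i :=
    (DerivedCategory.homologyFunctor _ i).mapIso e' ≪≫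
      (DerivedCategory.homologyFunctorFactors _ i).app K
  have hL (i : ℤ) : Module.Finite R (L.X i) ∧ Module.Projective R (L.X i) := by
    obtain ⟨h₁, h₂⟩ := hR.finite_projective_homology K (fun i => by
      have := (hK i).1
      have := (hK i).2
      exact Module.finitePresentation_of_projective R (K.X i)) i
    exact ⟨Module.Finite.equiv (α i).toLinearEquiv.symm,
      Module.Projective.of_equiv (α i).toLinearEquiv.symm⟩
  have hL' : ∀ i ∉ Finset.Icc a b, IsZero (L.X i) := by
    intro i hi
    refine .of_iso ?_ (α i)
    rw [Finset.mem_Icc, not_and_or, not_le, not_le] at hi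
    obtain hi | hi := hi
    · exact K.isZero_of_isGE a i hi
    · exact K.isZero_of_isLE b i hi
  have (i : ℤ) : ∃ (n : ℕ) (p : Fin n → (L.X i ⟶ ModuleCat.of R R))
      (q : Fin n → (ModuleCat.of R R ⟶ L.X i)), ∑ k, p k ≫ q k = 𝟙 (L.X i) := by
    obtain ⟨_, _⟩ := hL i
    exact exists_id_eq_sum_comp (L.X i)
  choose n p q hpq using this
  let A (j : Σ i, Fin (n i)) : PerfectDerivedCategory.{w} R :=
    ⟨_, isPerfectComplex_singleFunctor R j.1⟩
  let π (j : Σ i, Fin (n i)) : Xp ⟶ A j := ObjectProperty.homMk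
    (e.hom ≫ Q.map (mkHomToSingle (p j.1 j.2) fun l _ => zero_comp))
  let ε (j : Σ i, Fin (n i)) : A j ⟶ Xp := ObjectProperty.homMk
    (Q.map (mkHomFromSingle (q j.1 j.2) fun l _ => comp_zero) ≫ e.inv)
  obtain ⟨Y, hY, p', i', h⟩ := P.exists_factors_sum (hP 0)
    ((Finset.Icc a b).sigma fun _ => Finset.univ) A (fun j _ => hP j.1) π ε
  refine ⟨Y, hY, ⟨p', i', h.trans ?_⟩⟩
  refine (IsPerfectComplex.{w} R).ι.map_injective ?_
  rw [Functor.map_sum, CategoryTheory.Functor.map_id]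
  have key := congr_arg Q.map (L.sum_comp_single_eq_id (fun _ _ => rfl) hL' p q hpq)
  rw [Functor.map_sum, CategoryTheory.Functor.map_id] at key
  rw [show 𝟙 ((IsPerfectComplex.{w} R).ι.obj Xp) = e.hom ≫ 𝟙 (Q.obj L) ≫ e.inv by simp [Xp], ← key,
    Preadditive.sum_comp, Preadditive.comp_sum]
  refine Finset.sum_congr rfl fun j _ => ?_
  rw [Functor.map_comp, Functor.map_comp, Category.assoc]
  exact Category.assoc _ _ _

theorem IsVonNeumannRegularRing.rouquierDimension_eq_zero {R : Type u} [CommRing R]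
    [HasDerivedCategory.{w} (ModuleCat.{u} R)] (hR : IsVonNeumannRegularRing R) :
    rouquierDimension (PerfectDerivedCategory.{w} R) = 0 := by
  refine le_antisymm ?_ zero_le
  exact iInf₂_le_of_le 0 ⟨_, hR.triangEnvelopeIter_zero_eq_top⟩ le_rfl

end Rouquier

/-! ### Affine covers of the spectrum -/

section Spectrum

open AlgebraicGeometry TopologicalSpace

theorem IsVonNeumannRegularRing.exists_eq_basicOpen {R : Type u} [CommRing R]
    (hR : IsVonNeumannRegularRing R) (U : Opens (PrimeSpectrum R))
    (hU : IsCompact (U : Set (PrimeSpectrum R))) :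
    ∃ e : R, IsIdempotentElem e ∧ U = PrimeSpectrum.basicOpen e := by
  obtain ⟨I, hI, h⟩ := PrimeSpectrum.isCompact_isOpen_iff_ideal.1 ⟨hU, U.isOpen⟩
  obtain ⟨e, he, rfl⟩ := hR.exists_isIdempotentElem_span hI
  refine ⟨e, he, SetLike.coe_injective ?_⟩
  rw [← h, PrimeSpectrum.zeroLocus_span, PrimeSpectrum.basicOpen_eq_zeroLocus_compl]

/-- Both rings are localizations of `R` away from `e`. -/
theorem nonempty_ringEquiv_sections_basicOpen {R : CommRingCat.{u}} {U : (Spec R).Opens} {e : R}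
    (he : IsIdempotentElem e) (hU : U = PrimeSpectrum.basicOpen e) {S : Type v} [CommRing S]
    (ρ : R →+* S) (hρ : ∀ x y, ρ x = ρ y ↔ e * x = e * y) (hρ' : Function.Surjective ρ) :
    Nonempty (S ≃+* Γ(Spec R, U)) := by
  have : IsLocalization.Away e Γ(Spec R, U) := by
    subst hU
    infer_instance
  let := ρ.toAlgebra
  have : IsLocalization.Away e S := IsLocalization.away_of_isIdempotentElem_of_mul he hρ hρ'
  exact ⟨(IsLocalization.algEquiv (Submonoid.powers e) S Γ(Spec R, U)).toRingEquiv⟩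

/-- The sections of the structure sheaf of a power of a field over the open subset defined by an
idempotent are the functions on its support. -/
theorem nonempty_ringEquiv_support_sections {k : Type u} [Field k] {ι : Type v} {e : ι → k}
    (he : IsIdempotentElem e) {U : (Spec (CommRingCat.of (ι → k))).Opens}
    (hU : U = PrimeSpectrum.basicOpen e) :
    Nonempty ((Function.support e → k) ≃+* Γ(Spec (CommRingCat.of (ι → k)), U)) := by
  refine nonempty_ringEquiv_sections_basicOpen (R := CommRingCat.of (ι → k)) he hU
    (RingHom.pi fun i => Pi.evalRingHom (fun _ => k) i.1) (fun x y => ?_) fun y => ?_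
  · refine ⟨fun h => funext fun i => ?_, fun h => funext fun ⟨i, hi⟩ => ?_⟩
    · change e i * x i = e i * y i
      by_cases hi : e i = 0
      · rw [hi, zero_mul, zero_mul]
      · exact congr_arg (e i * ·) (congr_fun h ⟨i, hi⟩)
    · exact mul_left_cancel₀ hi (congr_fun h i)
  · classical
    refine ⟨fun i => if hi : i ∈ Function.support e then y ⟨i, hi⟩ else 0, funext fun i => ?_⟩
    exact dif_pos i.2

/-- Below an infinite cardinal, finite sums stay below it; regularity, which fails for `ℵ_ω`, is not
needed. -/
theorem exists_le_mk_of_finset_iUnion_eq_univ {α : Type v} {J : Type*} {c : Cardinal.{v}}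
    (hc : Cardinal.aleph0 ≤ c) (hα : c ≤ Cardinal.mk α) (s : Finset J) (A : J → Set α)
    (h : ⋃ j ∈ s, A j = Set.univ) : ∃ j ∈ s, c ≤ Cardinal.mk (A j) := by
  classical
  by_contra! hA
  have key (t : Finset J) (ht : t ⊆ s) : Cardinal.mk (⋃ j ∈ t, A j : Set α) < c := by
    induction t using Finset.induction_on with
    | empty => simpa using Cardinal.aleph0_pos.trans_le hc
    | insert j t _ ih =>
      rw [Finset.set_biUnion_insert]
      exact (Cardinal.mk_union_le _ _).trans_lt (Cardinal.add_lt_of_lt hc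
        (hA j (ht (Finset.mem_insert_self _ _)))
        (ih ((Finset.subset_insert _ _).trans ht)))
  have := key s subset_rfl
  rw [h, Cardinal.mk_univ] at this
  exact this.not_ge hα

theorem exists_globalDimension_eq_top_of_iSup_eq_top {k : Type u} [Field k] {ι : Type v}
    (hι : Cardinal.aleph Ordinal.omega0 ≤ Cardinal.mk ι)
    (𝒰 : Set (Spec (CommRingCat.of (ι → k))).affineOpens) (h𝒰 : (⨆ U ∈ 𝒰, U.1) = ⊤) :
    ∃ U ∈ 𝒰, globalDimension
      ((Spec (CommRingCat.of (ι → k))).presheaf.obj (.op U.1)) = ⊤ := by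
  have (U : 𝒰) := isVonNeumannRegularRing_pi.exists_eq_basicOpen (R := ι → k) U.1.1
    U.1.2.isCompact
  choose e he hU using this
  have hspan : Ideal.span (Set.range e) = ⊤ := by
    refine PrimeSpectrum.iSup_basicOpen_eq_top_iff.1 (Eq.trans ?_ h𝒰)
    rw [iSup_subtype']
    exact iSup_congr fun U => (hU U).symm
  obtain ⟨t, ht, hspan⟩ := (Ideal.span_eq_top_iff_finite _).1 hspan
  obtain ⟨a, ha, hcard⟩ := exists_le_mk_of_finset_iUnion_eq_univ (Cardinal.aleph0_le_aleph _) hι t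
    (fun a : ι → k => Function.support a) (by
      -- A point `i` outside all supports would put `t`, which generates the unit ideal, inside the
      -- kernel of evaluation at `i`.
      refine Set.eq_univ_of_forall fun i => ?_
      by_contra hi
      have hle : Ideal.span (t : Set (ι → k)) ≤ RingHom.ker (Pi.evalRingHom (fun _ : ι => k) i) :=
        Ideal.span_le.2 fun a ha => by
          by_contra h
          exact hi (Set.mem_biUnion ha h)
      rw [hspan] at hle
      exact one_ne_zero (hle (Submodule.mem_top (x := (1 : ι → k)))))
  obtain ⟨U, rfl⟩ := ht ha
  refine ⟨U.1, U.2, ?_⟩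
  obtain ⟨f⟩ := nonempty_ringEquiv_support_sections (he U) (hU U)
  exact (globalDimension_eq_of_ringEquiv f).symm.trans (globalDimension_pi_eq_top hcard)

end Spectrum

theorem mainTheorem2 {k : Type u} [Field k] {ι : Type v}
    (hι : Cardinal.mk ι = Cardinal.aleph Ordinal.omega0)
    [HasDerivedCategory.{w} (ModuleCat.{max u v} (ι → k))] :
    (∀ a b : ι → k, a * b = b * a) ∧
    IsCoherentRing (ι → k) ∧
    IsVonNeumannRegularRing (ι → k) ∧
    globalDimension (ι → k) = ⊤ ∧
    (∀ X, IsBoundedFinitelyPresented.{w} (ι → k) X → IsFormalComplex X) ∧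
    IsBoundedFinitelyPresented.{w} (ι → k) = IsPerfectComplex.{w} (ι → k) ∧
    rouquierDimension (PerfectDerivedCategory.{w} (ι → k)) = 0 ∧
    (∃ G : PerfectDerivedCategory.{w} (ι → k),
      (ObjectProperty.singleton G).IsStrongTriangulatedGenerator) ∧
    (∀ 𝒰 : Set (AlgebraicGeometry.Spec (CommRingCat.of (ι → k))).affineOpens,
      (⨆ U ∈ 𝒰, U.1) = ⊤ →
        ∃ U ∈ 𝒰, globalDimension
          ((AlgebraicGeometry.Spec (CommRingCat.of (ι → k))).presheaf.obj (.op U.1)) = ⊤) := by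
  have hR : IsVonNeumannRegularRing (ι → k) := isVonNeumannRegularRing_pi
  exact ⟨mul_comm, hR.isCoherentRing, hR, globalDimension_pi_eq_top hι.ge,
    fun _ => hR.isFormalComplex, hR.isBoundedFinitelyPresented_eq, hR.rouquierDimension_eq_zero,
    ⟨_, 0, hR.triangEnvelopeIter_zero_eq_top⟩, exists_globalDimension_eq_top_of_iSup_eq_top hι.ge⟩
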